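/- Let $M,K,J\ge 1$, $N=MK$, and write $x\in\mathbb{R}^N$ as $x=(x(\omega_1),\dots,x(\omega_M))$ with groups $x(\omega_m)\in\mathbb{R}^K$. A permutation $\sigma$ of $\{1,\dots,M\}$ acts by $\sigma(x)=(x(\omega_{\sigma(1)}),\dots,x(\omega_{\sigma(M)}))$; for $k\le K$ let $x_k\in\mathbb{R}^M$ be the vector of the $k$-th components of the $M$ groups. Let $\vec 1_n\in\mathbb{R}^n$ be the all-ones vector. Let $\mathcal X\subseteq\mathbb{R}^N$ be convex and invariant under all $\sigma$, let $\theta_1,\dots,\theta_J\in\mathcal X$, let $\hat v(\theta_1)\ge\dots\ge\hat v(\theta_J)$ be real numbers, put $\hat v(\theta_{J+1})=-\infty$, and let $L\ge 0$. Let $\mathcal U^\dagger$ be the set of bounded measurable $f:\mathcal X\to\mathbb{R}$ that are non-decreasing (componentwise order), quasiconcave, permutation invariant ($f(\sigma(y))=f(y)$ for all $\sigma$ and $y\in\mathcal X$), $L$-Lipschitz for $\|\cdot\|_\infty$, and satisfy $f(\theta_i)\ge\hat v(\theta_i)$ for all $i\le J$. Put $\psi_{\mathcal U^\dagger}(x)=\inf_{f\in\mathcal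 U^\dagger}f(x)$. For $\upsilon\le\hat v(\theta_1)$ let $\kappa(\upsilon)$ be the unique $j\in\{1,\dots,J\}$ with $\hat v(\theta_{j+1})<\upsilon\le\hat v(\theta_j)$. Let $\mathcal D_j$ consist of the first $j$ data points, and let $\mathscr P^\dagger_{LP}(x;\mathcal D_j)$ be the problem of minimizing $\upsilon$ over $\upsilon\in\mathbb{R}$, $\xi\in\mathbb{R}^N$, $y(\theta_i),w(\theta_i)\in\mathbb{R}^M$ $(i\le j)$ subject to $$\langle\vec 1_M,y(\theta_i)\rangle+\langle\vec 1_M,w(\theta_i)\rangle-\langle\xi,x\rangle+\upsilon-\hat v(\theta_i)\ge0,\qquad \sum_{k=1}^K(\theta_i)_k\,\xi_k^{\top}-y(\theta_i)\vec 1_M^{\top}-\vec 1_M\,w(\theta_i)^{\top}\ge0\quad(i\le j),$$ $$\xi\ge0,\qquad \|\xi\|_1\le L,$$ with matrix inequalities read entrywise. Let $x\in\mathcal X$ be such that $\sigma(\theta_i)-\|(\sigma(\theta_i)-x)^+\|_\infty\,\vec 1_N\in\mathcal X$ for all $i\le J$ and all $\sigma$, where $(\cdot)^+$ is the componentwise positive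 part (this always holds when $\mathcal X=\mathbb{R}^N$). Then $\psi_{\mathcal U^\dagger}(x)$ is a finite infimum, $j=\kappa(\psi_{\mathcal U^\dagger}(x))$ is well defined, the minimum in $\mathscr P^\dagger_{LP}(x;\mathcal D_j)$ is attained, and $$\psi_{\mathcal U^\dagger}(x)=\min\{\hat v(\theta_j),\ \mathsf{val}(\mathscr P^\dagger_{LP}(x;\mathcal D_j))\}.$$ Moreover $\mathscr P^\dagger_{LP}(x;\mathcal D_j)$ is a linear program of polynomial size: it has $1+MK+2jM$ real variables, and its feasible set is described by $j+jM^2+MK+1$ affine inequalities. -/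

import Mathlib

open scoped NNReal

noncomputable section

/-- Outcomes `x = (x(ω₁), …, x(ω_M))` made of `M` groups of size `K`, i.e. vectors of `ℝ^N` with
`N = M * K`. The order is componentwise and the norm of this product type is the sup norm. -/
abbrev Outcome (M K : ℕ) : Type := Fin M → Fin K → ℝ

namespace Outcome

variable {M K : ℕ}

/-- The Euclidean pairing `⟨ξ, x⟩` on `ℝ^(M * K)`. -/
def pairing (ξ x : Outcome M K) : ℝ := ∑ m, ∑ k, ξ m k * x m k

/-- `σ(x) = (x(ω_{σ(1)}), …, x(ω_{σ(M)}))`. -/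
def permute (σ : Equiv.Perm (Fin M)) (x : Outcome M K) : Outcome M K := fun m => x (σ m)

end Outcome

open Outcome

/-- The permutation invariant ambiguity set: bounded measurable functions on `X` that are monotone,
quasiconcave, invariant under permutations of the groups, `L`-Lipschitz for the sup norm, and
that dominate the lower bounds `v i` at the points `θ i`. Only the values of `f` on `X` matter. -/
def ambiguitySet {M K J : ℕ} (X : Set (Outcome M K)) (θ : Fin J → Outcome M K) (v : Fin J → ℝ)
    (L : ℝ≥0) : Set (Outcome M K → ℝ) :=
  {f | (∃ C : ℝ, ∀ y ∈ X, |f y| ≤ C) ∧ Measurable (X.domRestrict f) ∧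
    MonotoneOn f X ∧ QuasiconcaveOn ℝ X f ∧
    (∀ σ : Equiv.Perm (Fin M), ∀ y ∈ X, f (permute σ y) = f y) ∧
    LipschitzOnWith L f X ∧ ∀ i, v i ≤ f (θ i)}

/-- The pointwise worst-case evaluation `ψ(x) = inf {f x : f in the ambiguity set}`. -/
def worstCase {M K J : ℕ} (X : Set (Outcome M K)) (θ : Fin J → Outcome M K) (v : Fin J → ℝ)
    (L : ℝ≥0) (x : Outcome M K) : ℝ :=
  sInf ((fun f : Outcome M K → ℝ => f x) '' ambiguitySet X θ v L)

/-- Level selection: the indices `j` with `v (j+1) < u ≤ v j`, where the value after the last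
index is read as `-∞`. -/
def levelSelection {J : ℕ} (v : Fin J → ℝ) (u : ℝ) : Set (Fin J) :=
  {j | (∀ h : j.1 + 1 < J, v ⟨j.1 + 1, h⟩ < u) ∧ u ≤ v j}

/-- The index set of the top data points `θ_1, …, θ_j`. -/
abbrev TopIndex {J : ℕ} (j : Fin J) : Type := {i : Fin J // i ≤ j}

/-- The space of decision variables `(u, ξ, y, w)` of the linear program: `u` is real, `ξ` is in
`ℝ^(M * K)`, and there are vectors `y i`, `w i` of `ℝ^M` for each of the top data points. -/
abbrev LPVars (M K : ℕ) {J : ℕ} (j : Fin J) : Type :=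
  ℝ × Outcome M K × (TopIndex j → Fin M → ℝ) × (TopIndex j → Fin M → ℝ)

/-- Feasibility of `(u, ξ, y, w)` for the linear program at the point `x` with the top data points.
The matrix inequality `∑ k, θ_k ξ_kᵀ - y 1ᵀ - 1 wᵀ ≥ 0` is written entrywise. -/
def LPFeasible {M K J : ℕ} (θ : Fin J → Outcome M K) (v : Fin J → ℝ) (L : ℝ≥0)
    (x : Outcome M K) (j : Fin J) : LPVars M K j → Prop
  | (u, ξ, y, w) =>
    (∀ i : TopIndex j, 0 ≤ ∑ m, y i m + ∑ m, w i m - pairing ξ x + u - v i) ∧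
    (∀ (i : TopIndex j) (m l : Fin M), 0 ≤ ∑ k, θ i m k * ξ l k - y i m - w i l) ∧
    (∀ m k, 0 ≤ ξ m k) ∧
    ∑ m, ∑ k, |ξ m k| ≤ (L : ℝ)

/-- The objective values (the objective is `u`) attained on the feasible set. -/
def lpValues {M K J : ℕ} (θ : Fin J → Outcome M K) (v : Fin J → ℝ) (L : ℝ≥0)
    (x : Outcome M K) (j : Fin J) : Set ℝ :=
  {u | ∃ z : LPVars M K j, LPFeasible θ v L x j z ∧ z.1 = u}

/-- The optimal value of the linear program. -/
def lpVal {M K J : ℕ} (θ : Fin J → Outcome M K) (v : Fin J → ℝ) (L : ℝ≥0)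
    (x : Outcome M K) (j : Fin J) : ℝ :=
  sInf (lpValues θ v L x j)

end

/-!
The linear program is the problem of finding the lowest supporting affine function at `x`. By
duality for the assignment problem (`exists_assignment_potentials`, proved with Hall's marriage
theorem), the variables `y i`, `w i` certify a lower bound for `min_σ ⟨ξ, σ(θ i)⟩`. So `(u, ξ)`
extends to a feasible point exactly if `ξ ≥ 0`, `‖ξ‖₁ ≤ L`, and `z ↦ u + ⟨ξ, z - x⟩` is at least
`v i` at every permutation of `θ i`, for each of the top data points (`mem_lpValues_iff`). In this
form the minimum is attained by compactness.

*Lower bound* (`min_le_of_mem_ambiguitySet`). Let `f` be in the ambiguity set and `f x < t ≤ v j`.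
By the Lipschitz condition, `f ≥ t` at the points `σ(θ i) - ((v i - t) / L) 1`; these lie in `X`
by convexity, since `f x < t` forces `(v i - t) / L < ‖(σ(θ i) - x)⁺‖`. By quasiconcavity `f ≥ t`
on their convex hull, and by monotonicity the hull contains no point below `x`. A functional
separating the hull from the points below `x` is nonnegative, and scaled to `ℓ¹` norm `L` it shows
that `t` is a feasible value of the linear program. Hence `f x ≥ min (v j) (lpVal j)`, for every
`j`.

*Upper bound* (`exists_mem_ambiguitySet_le`). If `j` is the level of the worst case `ψ` and
`lpVal j < ψ`, take an optimal `ξ` and let `u < ψ` be the larger of `lpVal j` and the next data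
value. The minimum over all permutations of `z ↦ u + ⟨ξ, z - x⟩`, truncated to `[u, max v]`, is in
the ambiguity set: the lower truncation takes care of the data points after the `j`-th. Its value
at `x` is at most `u < ψ`, a contradiction.
-/

open Outcome

/-! ### Duality for the assignment problem -/

/-- The dual of the assignment problem has an optimal solution. A solution may be shifted by a
constant so that `max w = 0`; this confines the solutions with a not too small objective value to
a compact set. -/
theorem exists_maximal_assignment_potentials {ι : Type*} [Fintype ι] [Nonempty ι]
    (c : ι → ι → ℝ) :
    ∃ y w : ι → ℝ, (∀ m l, y m + w l ≤ c m l) ∧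
      ∀ y' w' : ι → ℝ, (∀ m l, y' m + w' l ≤ c m l) →
        ∑ m, y' m + ∑ l, w' l ≤ ∑ m, y m + ∑ l, w l := by
  set C : ℝ := ‖c‖
  obtain ⟨n, hn⟩ : ∃ n : ℝ, n = Fintype.card ι := ⟨_, rfl⟩
  have hc : ∀ m l, |c m l| ≤ C := fun m l =>
    (norm_le_pi_norm (c m) l).trans (norm_le_pi_norm c m)
  let S : Set ((ι → ℝ) × (ι → ℝ)) := {p | (∀ m l, p.1 m + p.2 l ≤ c m l) ∧ (∀ l, p.2 l ≤ 0) ∧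
    (∀ m, p.1 m ≤ C) ∧ -(n * C) ≤ ∑ m, p.1 m + ∑ l, p.2 l}
  have hclosed : IsClosed S := by
    simp only [S, Set.ofPred_and, Set.ofPred_forall]
    refine IsClosed.inter ?_ (IsClosed.inter ?_ (IsClosed.inter ?_ ?_))
    · exact isClosed_iInter fun m => isClosed_iInter fun l =>
        isClosed_le (by fun_prop) (by fun_prop)
    · exact isClosed_iInter fun l => isClosed_le (by fun_prop) (by fun_prop)
    · exact isClosed_iInter fun m => isClosed_le (by fun_prop) (by fun_prop)
    · exact isClosed_le (by fun_prop) (by fun_prop)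
  have hC : 0 ≤ C := norm_nonneg c
  have hsub : S ⊆ Set.Icc ((fun _ => -(2 * n * C)), (fun _ => -(2 * n * C)))
      ((fun _ => C), (fun _ => 0)) := by
    rintro ⟨y, w⟩ ⟨-, hw, hy, hs⟩
    simp only at hw hy hs
    have h1 : ∑ m, (C - y m) = n * C - ∑ m, y m := by simp [Finset.sum_sub_distrib, hn]
    have h2 : ∑ l, w l ≤ 0 := Finset.sum_nonpos fun l _ => hw l
    have h3 : ∑ m, y m ≤ n * C := by
      have : 0 ≤ ∑ m, (C - y m) := Finset.sum_nonneg fun m _ => sub_nonneg.2 (hy m)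
      linarith
    refine ⟨⟨fun m => ?_, fun l => ?_⟩, ⟨fun m => hy m, fun l => hw l⟩⟩
    · have h4 : C - y m ≤ ∑ m, (C - y m) :=
        Finset.single_le_sum (f := fun m => C - y m) (fun m _ => sub_nonneg.2 (hy m))
          (Finset.mem_univ m)
      simp only
      linarith
    · have h4 : -w l ≤ ∑ l, -w l :=
        Finset.single_le_sum (f := fun l => -w l) (fun l _ => neg_nonneg.2 (hw l))
          (Finset.mem_univ l)
      rw [Finset.sum_neg_distrib] at h4
      simp only
      linarith
  have hne : S.Nonempty := by
    refine ⟨(fun _ => -C, fun _ => 0), fun m l => ?_, fun l => le_rfl, fun m => ?_, ?_⟩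
    · simpa using (abs_le.1 (hc m l)).1
    · simp only
      linarith
    · simp [hn]
  obtain ⟨⟨y, w⟩, hyw, hmax⟩ := (isCompact_Icc.of_isClosed_subset hclosed hsub).exists_isMaxOn hne
    (f := fun p => ∑ m, p.1 m + ∑ l, p.2 l) (by fun_prop)
  refine ⟨y, w, hyw.1, fun y' w' h => ?_⟩
  by_cases hs : -(n * C) ≤ ∑ m, y' m + ∑ l, w' l
  · obtain ⟨l₀, hl₀⟩ := Finite.exists_max w'
    have hshift : ∑ m, (y' m + w' l₀) + ∑ l, (w' l - w' l₀) = ∑ m, y' m + ∑ l, w' l := by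
      rw [Finset.sum_add_distrib, Finset.sum_sub_distrib]
      ring
    have hmem : ((fun m => y' m + w' l₀, fun l => w' l - w' l₀) : (ι → ℝ) × (ι → ℝ)) ∈ S := by
      refine ⟨fun m l => ?_, fun l => sub_nonpos.2 (hl₀ l),
        fun m => (h m l₀).trans (le_of_abs_le (hc m l₀)), ?_⟩
      · have := h m l
        simp only
        linarith
      · simpa only [hshift] using hs
    have := hmax hmem
    simpa only [Set.mem_ofPred_eq, hshift] using this
  · exact (not_le.1 hs).le.trans hyw.2.2.2

/-- Strong duality for the assignment problem: some dual solution is as large as the cost of some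
assignment. At an optimal dual solution the tight entries satisfy the marriage condition: a set
of columns with too few tight rows would allow an improvement. -/
theorem exists_assignment_potentials {ι : Type*} [Fintype ι] [Nonempty ι] (c : ι → ι → ℝ) :
    ∃ (y w : ι → ℝ) (σ : Equiv.Perm ι), (∀ m l, y m + w l ≤ c m l) ∧
      ∑ m, y m + ∑ l, w l = ∑ l, c (σ l) l := by
  classical
  obtain ⟨y, w, hyw, hmax⟩ := exists_maximal_assignment_potentials c
  by_cases hall : ∀ A : Finset ι,
      A.card ≤ (Finset.univ.filter fun m => ∃ l ∈ A, y m + w l = c m l).card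
  · obtain ⟨f, hf, hr⟩ := (Fintype.all_card_le_filter_rel_iff_exists_injective
      (fun l m => y m + w l = c m l)).1 hall
    refine ⟨y, w, Equiv.ofBijective f (Finite.injective_iff_bijective.1 hf), hyw, ?_⟩
    have hσ := Equiv.sum_comp (Equiv.ofBijective f (Finite.injective_iff_bijective.1 hf)) y
    rw [← hσ, ← Finset.sum_add_distrib]
    exact Finset.sum_congr rfl fun l _ => hr l
  · exfalso
    push Not at hall
    obtain ⟨A, hA⟩ := hall
    set N := Finset.univ.filter fun m => ∃ l ∈ A, y m + w l = c m l with hN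
    obtain ⟨ε, hε, hε0⟩ : ∃ ε : ℝ, (∀ m l, y m + w l < c m l → ε ≤ c m l - (y m + w l)) ∧ 0 < ε := by
      have : ∀ᶠ ε in nhdsWithin (0 : ℝ) (Set.Ioi 0),
          ∀ m l, y m + w l < c m l → ε ≤ c m l - (y m + w l) := by
        simp only [Filter.eventually_all]
        intro m l h
        exact nhdsWithin_le_nhds (Iic_mem_nhds (sub_pos.2 h))
      exact (this.and self_mem_nhdsWithin).exists
    have hs := hmax (fun m => y m - if m ∈ N then ε else 0)
      (fun l => w l + if l ∈ A then ε else 0) fun m l => by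
        by_cases hm : m ∈ N
        · by_cases hl : l ∈ A <;> simp only [hm, hl, if_true, if_false] <;> linarith [hyw m l]
        · by_cases hl : l ∈ A
          · have hlt : y m + w l < c m l := lt_of_le_of_ne (hyw m l) fun h =>
              hm (by simpa [hN] using ⟨l, hl, h⟩)
            simp only [hm, hl, if_true, if_false]
            linarith [hε m l hlt]
          · simp only [hm, hl, if_false]
            linarith [hyw m l]
    simp only [Finset.sum_sub_distrib, Finset.sum_add_distrib, Finset.sum_ite_mem,
      Finset.univ_inter, Finset.sum_const, nsmul_eq_mul] at hs
    have : (N.card : ℝ) * ε < A.card * ε :=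
      mul_lt_mul_of_pos_right (by exact_mod_cast hA) hε0
    linarith

/-! ### The pairing -/

namespace Outcome

variable {M K : ℕ}

theorem pairing_add (ξ z z' : Outcome M K) : pairing ξ (z + z') = pairing ξ z + pairing ξ z' := by
  simp [pairing, mul_add, Finset.sum_add_distrib]

theorem pairing_smul (ξ : Outcome M K) (a : ℝ) (z : Outcome M K) :
    pairing ξ (a • z) = a * pairing ξ z := by
  simp [pairing, Finset.mul_sum, mul_left_comm]

theorem pairing_sub (ξ z z' : Outcome M K) : pairing ξ (z - z') = pairing ξ z - pairing ξ z' := by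
  simp [pairing, mul_sub, Finset.sum_sub_distrib]

theorem smul_pairing (a : ℝ) (ξ z : Outcome M K) : pairing (a • ξ) z = a * pairing ξ z := by
  simp [pairing, Finset.mul_sum, mul_assoc]

theorem pairing_one (ξ : Outcome M K) : pairing ξ 1 = ∑ m, ∑ k, ξ m k := by
  simp [pairing]

theorem pairing_le_pairing {ξ z z' : Outcome M K} (hξ : ∀ m k, 0 ≤ ξ m k) (h : z ≤ z') :
    pairing ξ z ≤ pairing ξ z' :=
  Finset.sum_le_sum fun m _ => Finset.sum_le_sum fun k _ =>
    mul_le_mul_of_nonneg_left (h m k) (hξ m k)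

theorem abs_pairing_le (ξ z : Outcome M K) : |pairing ξ z| ≤ (∑ m, ∑ k, |ξ m k|) * ‖z‖ := by
  simp only [pairing, Finset.sum_mul]
  refine (Finset.abs_sum_le_sum_abs _ _).trans (Finset.sum_le_sum fun m _ =>
    (Finset.abs_sum_le_sum_abs _ _).trans (Finset.sum_le_sum fun k _ => ?_))
  rw [abs_mul]
  exact mul_le_mul_of_nonneg_left
    ((norm_le_pi_norm (z m) k).trans (norm_le_pi_norm z m)) (abs_nonneg _)

/-- Every linear functional on outcomes is given by the pairing. -/
theorem exists_pairing_eq (G : Outcome M K →ₗ[ℝ] ℝ) : ∃ ξ, ∀ z, G z = pairing ξ z := by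
  refine ⟨fun m k => G (Pi.single m (Pi.single k 1)), fun z => ?_⟩
  have hz : z = ∑ m, ∑ k, z m k • (Pi.single m (Pi.single k 1) : Outcome M K) := by
    ext a b
    simp [Finset.sum_apply, Pi.single_apply, apply_ite, ite_apply]
  conv_lhs => rw [hz]
  simp [pairing, mul_comm]

theorem pairing_single (ξ : Outcome M K) (m : Fin M) (k : Fin K) :
    pairing ξ (Pi.single m (Pi.single k 1)) = ξ m k := by
  simp [pairing, Pi.single_apply, apply_ite, ite_apply]

theorem norm_permute_le (σ : Equiv.Perm (Fin M)) (z : Outcome M K) : ‖permute σ z‖ ≤ ‖z‖ :=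
  (pi_norm_le_iff_of_nonneg (norm_nonneg z)).2 fun m => norm_le_pi_norm z (σ m)

@[fun_prop]
theorem continuous_pairing {α : Type*} [TopologicalSpace α] {f g : α → Outcome M K}
    (hf : Continuous f) (hg : Continuous g) : Continuous fun a => pairing (f a) (g a) := by
  unfold pairing
  fun_prop

end Outcome

/-! ### The linear program without assignment potentials -/

section LinearProgram

variable {M K J : ℕ} {θ : Fin J → Outcome M K} {v : Fin J → ℝ} {L : ℝ≥0} {x : Outcome M K}
  {j : Fin J}

/-- Eliminating `y` and `w` from the linear program: by duality for the assignment problem, these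
variables encode that the supporting affine function `z ↦ u + ⟨ξ, z - x⟩` dominates `v i` at all
permutations of `θ i`. -/
theorem exists_lpFeasible_iff [Nonempty (Fin M)] {u : ℝ} {ξ : Outcome M K} :
    (∃ y w, LPFeasible θ v L x j (u, ξ, y, w)) ↔
      (∀ m k, 0 ≤ ξ m k) ∧ ∑ m, ∑ k, |ξ m k| ≤ (L : ℝ) ∧
      ∀ (i : TopIndex j) (σ : Equiv.Perm (Fin M)),
        v i + pairing ξ x ≤ u + pairing ξ (permute σ (θ i)) := by
  have hsum : ∀ (i : Fin J) (σ : Equiv.Perm (Fin M)),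
      ∑ l, ∑ k, θ i (σ l) k * ξ l k = pairing ξ (permute σ (θ i)) := fun i σ => by
    simp [pairing, permute, mul_comm]
  constructor
  · rintro ⟨y, w, h1, h2, h3, h4⟩
    refine ⟨h3, h4, fun i σ => ?_⟩
    have h5 : ∑ l, (y i (σ l) + w i l) ≤ ∑ l, ∑ k, θ i (σ l) k * ξ l k :=
      Finset.sum_le_sum fun l _ => by linarith [h2 i (σ l) l]
    rw [Finset.sum_add_distrib, Equiv.sum_comp σ (y i), hsum] at h5
    linarith [h1 i]
  · rintro ⟨h3, h4, h5⟩
    choose y w σ hyw hσ using fun i : TopIndex j =>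
      exists_assignment_potentials fun m l => ∑ k, θ i m k * ξ l k
    refine ⟨y, w, fun i => ?_, fun i m l => by linarith [hyw i m l], h3, h4⟩
    have := hσ i
    rw [hsum] at this
    linarith [h5 i (σ i)]

theorem mem_lpValues_iff [Nonempty (Fin M)] {u : ℝ} :
    u ∈ lpValues θ v L x j ↔ ∃ ξ : Outcome M K,
      (∀ m k, 0 ≤ ξ m k) ∧ ∑ m, ∑ k, |ξ m k| ≤ (L : ℝ) ∧
      ∀ (i : TopIndex j) (σ : Equiv.Perm (Fin M)),
        v i + pairing ξ x ≤ u + pairing ξ (permute σ (θ i)) := by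
  simp only [← exists_lpFeasible_iff]
  constructor
  · rintro ⟨⟨u, ξ, y, w⟩, h, rfl⟩
    exact ⟨ξ, y, w, h⟩
  · rintro ⟨ξ, y, w, h⟩
    exact ⟨⟨u, ξ, y, w⟩, h, rfl⟩

/-- The linear program attains its minimum: in the reduced form, the feasible pairs `(u, ξ)` with
`u` below a given feasible value form a compact set. -/
theorem isLeast_lpVal [Nonempty (Fin M)] :
    IsLeast (lpValues θ v L x j) (lpVal θ v L x j) := by
  suffices ∃ a, IsLeast (lpValues θ v L x j) a by
    obtain ⟨a, ha⟩ := this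
    rwa [lpVal, ha.csInf_eq]
  obtain ⟨V, hV⟩ := (Set.finite_range v).bddAbove
  replace hV : ∀ i, v i ≤ V := fun i => hV ⟨i, rfl⟩
  let S : Set (ℝ × Outcome M K) := {p | p.1 ≤ V ∧ (∀ m k, 0 ≤ p.2 m k) ∧
    ∑ m, ∑ k, |p.2 m k| ≤ (L : ℝ) ∧ ∀ (i : TopIndex j) (σ : Equiv.Perm (Fin M)),
      v i + pairing p.2 x ≤ p.1 + pairing p.2 (permute σ (θ i))}
  have hclosed : IsClosed S := by
    simp only [S, Set.ofPred_and, Set.ofPred_forall]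
    refine IsClosed.inter ?_ (IsClosed.inter ?_ (IsClosed.inter ?_ ?_))
    · exact isClosed_le (by fun_prop) (by fun_prop)
    · exact isClosed_iInter fun m => isClosed_iInter fun k =>
        isClosed_le (by fun_prop) (by fun_prop)
    · exact isClosed_le (by fun_prop) (by fun_prop)
    · exact isClosed_iInter fun i => isClosed_iInter fun σ =>
        isClosed_le (by fun_prop) (by fun_prop)
  have hsub : S ⊆ Set.Icc (v j - L * ‖θ j - x‖, 0) (V, fun _ _ => (L : ℝ)) := by
    rintro ⟨u, ξ⟩ ⟨hu, h0, hL, h⟩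
    simp only at hu h0 hL h
    have h1 : v j + pairing ξ x ≤ u + pairing ξ (θ j) := h ⟨j, le_rfl⟩ 1
    have h2 := (abs_le.1 ((abs_pairing_le ξ (θ j - x)).trans
      (mul_le_mul_of_nonneg_right hL (norm_nonneg _)))).2
    rw [pairing_sub] at h2
    refine ⟨⟨by simp only; linarith, h0⟩, ⟨hu, fun m k => ?_⟩⟩
    calc ξ m k ≤ |ξ m k| := le_abs_self _
      _ ≤ ∑ k, |ξ m k| :=
        Finset.single_le_sum (f := fun k => |ξ m k|) (fun _ _ => abs_nonneg _) (Finset.mem_univ k)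
      _ ≤ ∑ m, ∑ k, |ξ m k| :=
        Finset.single_le_sum (f := fun m => ∑ k, |ξ m k|)
          (fun _ _ => Finset.sum_nonneg fun _ _ => abs_nonneg _) (Finset.mem_univ m)
      _ ≤ L := hL
  have hne : S.Nonempty := by
    refine ⟨(V, 0), le_rfl, fun _ _ => le_rfl, by simp, fun i σ => ?_⟩
    simpa [pairing] using hV i
  obtain ⟨⟨u, ξ⟩, hu, hmin⟩ := (isCompact_Icc.of_isClosed_subset hclosed hsub).exists_isMinOn hne
    continuousOn_fst
  refine ⟨u, mem_lpValues_iff.2 ⟨ξ, hu.2⟩, fun u' hu' => ?_⟩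
  by_cases hV' : u' ≤ V
  · obtain ⟨ξ', h⟩ := mem_lpValues_iff.1 hu'
    exact hmin (show (u', ξ') ∈ S from ⟨hV', h⟩)
  · exact hu.1.trans (not_le.1 hV').le

end LinearProgram

/-! ### Every member of the ambiguity set dominates the linear program -/

section LowerBound

variable {M K J : ℕ} {X : Set (Outcome M K)} {θ : Fin J → Outcome M K} {v : Fin J → ℝ} {L : ℝ≥0}
  {x : Outcome M K}

theorem lipschitz_lower_bound {f : Outcome M K → ℝ} (hf : LipschitzOnWith L f X)
    {y z : Outcome M K} (hy : y ∈ X) (hz : z ∈ X) : f y - L * ‖y - z‖ ≤ f z := by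
  have := hf.dist_le_mul y hy z hz
  rw [Real.dist_eq, dist_eq_norm] at this
  linarith [(abs_le.1 this).2]

/-- If a compact convex set `C` contains no point below `x`, then some nonzero nonnegative price
vector values every point of `C` at least as high as `x`. -/
theorem exists_pairing_separating {C : Set (Outcome M K)} (hconv : Convex ℝ C) (hcomp : IsCompact C)
    (hne : C.Nonempty) (hC : ∀ z ∈ C, ¬ z ≤ x) :
    ∃ ξ : Outcome M K, (∀ m k, 0 ≤ ξ m k) ∧ 0 < ∑ m, ∑ k, ξ m k ∧
      ∀ z ∈ C, pairing ξ x ≤ pairing ξ z := by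
  obtain ⟨F, a, b, ha, hab, hb⟩ := geometric_hahn_banach_compact_closed hconv hcomp
    (convex_Iic x) isClosed_Iic (Set.disjoint_left.2 hC)
  obtain ⟨ξ, hξ⟩ := exists_pairing_eq (-F.toLinearMap)
  replace hξ : ∀ z, F z = -pairing ξ z := fun z => by
    have := hξ z
    simp only [LinearMap.neg_apply, ContinuousLinearMap.coe_coe] at this
    linarith
  simp only [hξ] at ha hb
  have h0 : ∀ m k, 0 ≤ ξ m k := by
    intro m k
    by_contra! hneg
    have hx := hb x (Set.mem_Iic.2 le_rfl)
    -- moving down along the coordinate `(m, k)` until the functional takes the value `b`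
    set s : ℝ := (b + pairing ξ x) / ξ m k with hs
    have hs0 : 0 ≤ s := div_nonneg_of_nonpos (by linarith) hneg.le
    have hle : x - s • (Pi.single m (Pi.single k 1) : Outcome M K) ≤ x := by
      refine sub_le_self x (smul_nonneg hs0 ?_)
      rw [Pi.single_nonneg, Pi.single_nonneg]
      exact zero_le_one
    have := hb _ hle
    rw [pairing_sub, pairing_smul, pairing_single, hs, div_mul_cancel₀ _ hneg.ne] at this
    linarith
  have hle : ∀ z ∈ C, pairing ξ x < pairing ξ z := fun z hz => by
    linarith [ha z hz, hb x (Set.mem_Iic.2 le_rfl)]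
  refine ⟨ξ, h0, ?_, fun z hz => (hle z hz).le⟩
  obtain ⟨z, hz⟩ := hne
  refine lt_of_le_of_ne (Finset.sum_nonneg fun m _ => Finset.sum_nonneg fun k _ => h0 m k) fun h => ?_
  have hzero : ∀ m k, ξ m k = 0 := fun m k => by
    have h1 := (Finset.sum_eq_zero_iff_of_nonneg
      fun m _ => Finset.sum_nonneg fun k _ => h0 m k).1 h.symm m (Finset.mem_univ m)
    exact (Finset.sum_eq_zero_iff_of_nonneg fun k _ => h0 m k).1 h1 k (Finset.mem_univ k)
  simpa [pairing, hzero] using hle z hz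

/-- A level `t ≤ v j` above the value `f x` of a member of the ambiguity set is a feasible value of
the linear program. Lowering each `σ(θ i)` along the diagonal by `(v i - t) / L` gives points at
which `f` is at least `t`; hence so is `f` on their convex hull, which therefore contains no point
below `x`, and a separating price vector is feasible. -/
theorem mem_lpValues_of_lt (hM : 1 ≤ M) (hXconv : Convex ℝ X)
    (hXperm : ∀ σ : Equiv.Perm (Fin M), ∀ y ∈ X, permute σ y ∈ X)
    (hθ : ∀ i, θ i ∈ X) (hv : Antitone v) (hx : x ∈ X)
    (hXlow : ∀ (i : Fin J) (σ : Equiv.Perm (Fin M)),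
      permute σ (θ i) - ‖(permute σ (θ i) - x)⁺‖ • (1 : Outcome M K) ∈ X)
    {f : Outcome M K → ℝ} (hf : f ∈ ambiguitySet X θ v L) {j : Fin J} {t : ℝ}
    (hft : f x < t) (htj : t ≤ v j) : t ∈ lpValues θ v L x j := by
  obtain ⟨-, -, hmono, hquasi, hperm, hlip, hdata⟩ := hf
  have : Nonempty (Fin M) := ⟨⟨0, hM⟩⟩
  have htv : ∀ i : TopIndex j, t ≤ v i := fun i => htj.trans (hv i.2)
  have hval : ∀ (i : Fin J) (σ : Equiv.Perm (Fin M)), v i ≤ f (permute σ (θ i)) := fun i σ => by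
    rw [hperm σ _ (hθ i)]
    exact hdata i
  have hone : ∀ a : ℝ, 0 ≤ a → ‖a • (1 : Outcome M K)‖ ≤ a := fun a ha => by
    refine (pi_norm_le_iff_of_nonneg ha).2 fun m => (pi_norm_le_iff_of_nonneg ha).2 fun k => ?_
    simp [abs_of_nonneg ha]
  have hlow : ∀ (i : Fin J) (σ : Equiv.Perm (Fin M)) (a : ℝ), 0 ≤ a →
      permute σ (θ i) - a • (1 : Outcome M K) ∈ X →
      v i - L * a ≤ f (permute σ (θ i) - a • (1 : Outcome M K)) := fun i σ a ha hmem => by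
    have h1 := lipschitz_lower_bound hlip (hXperm σ _ (hθ i)) hmem
    rw [sub_sub_cancel] at h1
    have h2 := mul_le_mul_of_nonneg_left (hone a ha) L.2
    linarith [hval i σ, show (L : ℝ) * ‖a • (1 : Outcome M K)‖ ≤ L * a from h2]
  -- the lowered points with lowering `‖(σ(θ i) - x)⁺‖` lie below `x`
  have hgap : ∀ (i : Fin J) (σ : Equiv.Perm (Fin M)),
      v i - t < L * ‖(permute σ (θ i) - x)⁺‖ := fun i σ => by
    have h1 := hlow i σ _ (norm_nonneg _) (hXlow i σ)
    have h2 : permute σ (θ i) - ‖(permute σ (θ i) - x)⁺‖ • (1 : Outcome M K) ≤ x := fun m k => by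
      have h3 : (permute σ (θ i) - x)⁺ m k ≤ ‖(permute σ (θ i) - x)⁺‖ :=
        (le_abs_self _).trans ((norm_le_pi_norm ((permute σ (θ i) - x)⁺ m) k).trans
          (norm_le_pi_norm (permute σ (θ i) - x)⁺ m))
      have h4 : (permute σ (θ i) - x) m k ≤ (permute σ (θ i) - x)⁺ m k :=
        le_posPart (permute σ (θ i) - x) m k
      simp only [Pi.sub_apply, Pi.smul_apply, Pi.one_apply, smul_eq_mul, mul_one] at h4 ⊢
      linarith
    linarith [hmono (hXlow i σ) hx h2]
  have hL : 0 < (L : ℝ) := by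
    rcases L.2.eq_or_lt with h | h
    · have h1 := hgap j 1
      rw [show (L : ℝ) = 0 from h.symm, zero_mul] at h1
      linarith
    · exact h
  set a : TopIndex j → ℝ := fun i => (v i - t) / L with ha
  have ha0 : ∀ i, 0 ≤ a i := fun i => div_nonneg (sub_nonneg.2 (htv i)) hL.le
  have hLa : ∀ i, L * a i = v i - t := fun i => mul_div_cancel₀ _ hL.ne'
  set p : TopIndex j × Equiv.Perm (Fin M) → Outcome M K := fun q =>
    permute q.2 (θ q.1) - a q.1 • (1 : Outcome M K) with hp
  have hpX : ∀ q, p q ∈ X := fun q => by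
    obtain ⟨i, σ⟩ := q
    set n := ‖(permute σ (θ i) - x)⁺‖ with hn
    have han : a i < n := by
      have h1 := hgap i σ
      rw [← hLa i] at h1
      exact lt_of_mul_lt_mul_left h1 hL.le
    have hn0 : 0 < n := (ha0 i).trans_lt han
    have h2 := hXconv (hXperm σ _ (hθ i)) (hXlow i σ)
      (sub_nonneg.2 ((div_le_one hn0).2 han.le)) (div_nonneg (ha0 i) hn0.le) (sub_add_cancel _ _)
    convert h2 using 1
    rw [← hn, smul_sub, smul_smul, div_mul_cancel₀ _ hn0.ne', sub_smul, one_smul]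
    simp only [hp]
    abel
  have hhull : convexHull ℝ (Set.range p) ⊆ {z ∈ X | t ≤ f z} := by
    refine convexHull_min ?_ (hquasi t)
    rintro _ ⟨q, rfl⟩
    refine ⟨hpX q, ?_⟩
    have := hlow q.1 q.2 (a q.1) (ha0 q.1) (hpX q)
    rw [hLa] at this
    simpa using this
  obtain ⟨ξ, h0, hS, hsep⟩ := exists_pairing_separating (x := x) (convex_convexHull ℝ (Set.range p))
    ((Set.finite_range p).isCompact_convexHull ℝ)
    ⟨_, subset_convexHull ℝ _ ⟨(⟨j, le_rfl⟩, 1), rfl⟩⟩ fun z hz hzx => by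
      have h1 := hhull hz
      exact absurd (h1.2.trans (hmono h1.1 hx hzx)) (not_le.2 hft)
  set S := ∑ m, ∑ k, ξ m k with hSdef
  have hc : 0 < (L : ℝ) / S := div_pos hL hS
  refine mem_lpValues_iff.2 ⟨((L : ℝ) / S) • ξ, fun m k => mul_nonneg hc.le (h0 m k), ?_,
    fun i σ => ?_⟩
  · have h1 : ∀ m k, |(((L : ℝ) / S) • ξ) m k| = (L : ℝ) / S * ξ m k := fun m k =>
      abs_of_nonneg (mul_nonneg hc.le (h0 m k))
    simp only [h1, ← Finset.mul_sum]
    exact (div_mul_cancel₀ _ hS.ne').le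
  · have h1 := hsep _ (subset_convexHull ℝ _ ⟨(i, σ), rfl⟩)
    rw [hp, pairing_sub, pairing_smul, pairing_one, ← hSdef] at h1
    have h2 := mul_le_mul_of_nonneg_left h1 hc.le
    have h3 : (L : ℝ) / S * (a i * S) = v i - t := by
      rw [← hLa i]
      field_simp
    simp only at h2
    rw [mul_sub, h3] at h2
    rw [smul_pairing, smul_pairing]
    linarith

/-- Each member of the ambiguity set is at least `min (v j) (lpVal j)` at `x`, for every `j`. -/
theorem min_le_of_mem_ambiguitySet (hM : 1 ≤ M) (hXconv : Convex ℝ X)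
    (hXperm : ∀ σ : Equiv.Perm (Fin M), ∀ y ∈ X, permute σ y ∈ X)
    (hθ : ∀ i, θ i ∈ X) (hv : Antitone v) (hx : x ∈ X)
    (hXlow : ∀ (i : Fin J) (σ : Equiv.Perm (Fin M)),
      permute σ (θ i) - ‖(permute σ (θ i) - x)⁺‖ • (1 : Outcome M K) ∈ X)
    {f : Outcome M K → ℝ} (hf : f ∈ ambiguitySet X θ v L) (j : Fin J) :
    min (v j) (lpVal θ v L x j) ≤ f x := by
  have : Nonempty (Fin M) := ⟨⟨0, hM⟩⟩
  refine le_of_forall_gt_imp_ge_of_dense fun t ht => ?_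
  rcases le_total t (v j) with htj | htj
  · exact (min_le_right _ _).trans
      (isLeast_lpVal.2 (mem_lpValues_of_lt hM hXconv hXperm hθ hv hx hXlow hf ht htj))
  · exact (min_le_left _ _).trans htj

end LowerBound

/-! ### A worst-case function -/

section UpperBound

variable {M K J : ℕ} {X : Set (Outcome M K)} {θ : Fin J → Outcome M K} {v : Fin J → ℝ} {L : ℝ≥0}
  {x : Outcome M K}

/-- The least price of a permutation of `z` at the price vector `ξ`. -/
noncomputable def minPairing (ξ z : Outcome M K) : ℝ :=
  Finset.univ.inf' ⟨1, Finset.mem_univ _⟩ fun σ : Equiv.Perm (Fin M) => pairing ξ (permute σ z)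

theorem minPairing_le (ξ z : Outcome M K) (σ : Equiv.Perm (Fin M)) :
    minPairing ξ z ≤ pairing ξ (permute σ z) :=
  Finset.inf'_le (fun σ : Equiv.Perm (Fin M) => pairing ξ (permute σ z)) (Finset.mem_univ σ)

theorem le_minPairing {ξ z : Outcome M K} {a : ℝ}
    (h : ∀ σ : Equiv.Perm (Fin M), a ≤ pairing ξ (permute σ z)) : a ≤ minPairing ξ z :=
  Finset.le_inf' _ _ fun σ _ => h σ

theorem minPairing_mono {ξ : Outcome M K} (hξ : ∀ m k, 0 ≤ ξ m k) : Monotone (minPairing ξ) :=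
  fun z _ h => le_minPairing fun σ => (minPairing_le ξ z σ).trans
    (pairing_le_pairing hξ fun m => h (σ m))

theorem minPairing_permute (ξ z : Outcome M K) (τ : Equiv.Perm (Fin M)) :
    minPairing ξ (permute τ z) = minPairing ξ z := by
  refine le_antisymm (le_minPairing fun σ => ?_) (le_minPairing fun σ => ?_)
  · refine (minPairing_le ξ (permute τ z) (τ⁻¹ * σ)).trans_eq ?_
    rw [show permute (τ⁻¹ * σ) (permute τ z) = permute (τ * (τ⁻¹ * σ)) z from rfl,
      mul_inv_cancel_left]
  · exact minPairing_le ξ z (τ * σ)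

theorem concaveOn_minPairing (ξ : Outcome M K) (hX : Convex ℝ X) :
    ConcaveOn ℝ X (minPairing ξ) := by
  refine ⟨hX, fun y _ z _ a b ha hb _ => le_minPairing fun σ => ?_⟩
  rw [show permute σ (a • y + b • z) = a • permute σ y + b • permute σ z from rfl,
    pairing_add, pairing_smul, pairing_smul]
  exact add_le_add (mul_le_mul_of_nonneg_left (minPairing_le ξ y σ) ha)
    (mul_le_mul_of_nonneg_left (minPairing_le ξ z σ) hb)

theorem lipschitzWith_minPairing {ξ : Outcome M K} (hL : ∑ m, ∑ k, |ξ m k| ≤ (L : ℝ)) :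
    LipschitzWith L (minPairing ξ) := by
  refine LipschitzWith.of_le_add_mul L fun y z => ?_
  rw [← sub_le_iff_le_add]
  refine le_minPairing fun σ => ?_
  have h1 := (abs_le.1 ((abs_pairing_le ξ (permute σ (y - z))).trans
    (mul_le_mul hL (norm_permute_le σ _) (norm_nonneg _) L.2))).2
  rw [show permute σ (y - z) = permute σ y - permute σ z from rfl, pairing_sub] at h1
  rw [dist_eq_norm]
  linarith [minPairing_le ξ y σ]

/-- A feasible pair `(u, ξ)` for the top data points `θ i`, `i ≤ j`, yields a member of the
ambiguity set with value at most `u` at `x`, provided that `u` dominates `v` at the remaining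
points. It is the minimum over all permutations of `z ↦ u + ⟨ξ, z - x⟩`, truncated to `[u, V]`
for a bound `V` of all data. Quasiconcavity, unlike concavity, survives the lower truncation. -/
theorem exists_mem_ambiguitySet_le (hXconv : Convex ℝ X) {V u : ℝ} (hV : ∀ i, v i ≤ V)
    {j : Fin J} (hu : ∀ i, j < i → v i ≤ u) {ξ : Outcome M K} (h0 : ∀ m k, 0 ≤ ξ m k)
    (hL : ∑ m, ∑ k, |ξ m k| ≤ (L : ℝ))
    (hξ : ∀ (i : TopIndex j) (σ : Equiv.Perm (Fin M)),
      v i + pairing ξ x ≤ u + pairing ξ (permute σ (θ i))) :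
    ∃ f ∈ ambiguitySet X θ v L, f x ≤ u := by
  set g : ℝ → ℝ := fun r => max u (min V r) with hg
  have hgmono : Monotone g := fun r s h => max_le_max le_rfl (min_le_min le_rfl h)
  set h : Outcome M K → ℝ := fun z => (u - pairing ξ x) + minPairing ξ z with hh
  have hlip : LipschitzWith L (g ∘ h) := by
    have h1 : LipschitzWith L h := by
      refine LipschitzWith.of_dist_le_mul fun y z => ?_
      simpa [hh] using (lipschitzWith_minPairing hL).dist_le_mul y z
    exact (h1.const_min V).const_max u
  refine ⟨g ∘ h, ⟨⟨max |u| |V|, fun y _ => ?_⟩, ?_, fun y _ z _ hyz => ?_, ?_, fun σ y _ => ?_,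
    hlip.lipschitzOnWith, fun i => ?_⟩, ?_⟩
  · simp only [hg, Function.comp]
    refine abs_le.2 ⟨?_, ?_⟩
    · exact (neg_le_neg (le_max_left _ _)).trans ((neg_abs_le u).trans (le_max_left _ _))
    · exact max_le ((le_abs_self u).trans (le_max_left _ _))
        ((min_le_left _ _).trans ((le_abs_self V).trans (le_max_right _ _)))
  · exact (hlip.continuous.comp continuous_subtype_val).measurable
  · exact hgmono (add_le_add le_rfl (minPairing_mono h0 hyz))
  · exact QuasiconcaveOn.monotone_comp hgmono
      (((concaveOn_const (u - pairing ξ x) hXconv).add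
        (concaveOn_minPairing ξ hXconv)).quasiconcaveOn)
  · simp only [hh, Function.comp, minPairing_permute]
  · rcases le_or_gt i j with hij | hij
    · refine le_max_of_le_right (le_min (hV i) ?_)
      have : v i + pairing ξ x - u ≤ minPairing ξ (θ i) :=
        le_minPairing fun σ => by linarith [hξ ⟨i, hij⟩ σ]
      simp only [hh]
      linarith
    · exact le_max_of_le_left (hu i hij)
  · refine max_le le_rfl ((min_le_right _ _).trans ?_)
    have : minPairing ξ x ≤ pairing ξ x := minPairing_le ξ x 1
    simp only [hh]
    linarith

end UpperBound

/-! ### Levels and the size of the linear program -/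

/-- The selected index is the largest one whose value is at least `u`. -/
theorem exists_levelSelection_eq_singleton {J : ℕ} {v : Fin J → ℝ} (hv : Antitone v)
    (hJ : 0 < J) {u : ℝ} (hu : u ≤ v ⟨0, hJ⟩) : ∃ j, levelSelection v u = {j} := by
  obtain ⟨j, hj, hmax⟩ := (Set.toFinite {i | u ≤ v i}).exists_maximal ⟨_, hu⟩
  have hlt : ∀ i, j < i → v i < u := fun i hi => by
    by_contra! h
    exact absurd (hmax h hi.le) (not_le.2 hi)
  refine ⟨j, Set.eq_singleton_iff_unique_mem.2
    ⟨⟨fun h => hlt _ (Fin.lt_def.2 (Nat.lt_succ_self _)), hj⟩, fun i hi => ?_⟩⟩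
  rcases lt_trichotomy i j with h | h | h
  · have h1 : (i : ℕ) + 1 < J := lt_of_le_of_lt (Nat.succ_le_of_lt h) j.2
    exact absurd (hj.trans (hv (Fin.le_def.2 (Nat.succ_le_of_lt h)))) (not_le.2 (hi.1 h1))
  · exact h
  · exact absurd hi.2 (not_le.2 (hlt i h))

theorem card_topIndex {J : ℕ} (j : Fin J) : Fintype.card (TopIndex j) = j + 1 := by
  rw [Fintype.card_subtype]
  simp [Finset.filter_ge_eq_Iic]

theorem finrank_lpVars (M K : ℕ) {J : ℕ} (j : Fin J) :
    Module.finrank ℝ (LPVars M K j) = 1 + M * K + 2 * ((j + 1) * M) := by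
  simp only [Module.finrank_prod, Module.finrank_self, Module.finrank_pi_fintype,
    Finset.sum_const, Finset.card_univ, Fintype.card_fin, card_topIndex, smul_eq_mul]
  ring

theorem IsLinearMap.exists_affineMap {V : Type*} [AddCommGroup V] [Module ℝ V] {φ : V → ℝ}
    (hφ : IsLinearMap ℝ φ) (b : ℝ) : ∃ g : V →ᵃ[ℝ] ℝ, ∀ z, g z = φ z + b :=
  ⟨(hφ.mk' φ).toAffineMap + AffineMap.const ℝ V b, fun z => by simp⟩

/-- The feasible set is cut out by affine inequalities. On the nonnegative orthant the constraint
on the `ℓ¹` norm of `ξ` is the affine inequality `∑ m, ∑ k, ξ m k ≤ L`. -/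
theorem exists_affine_lpFeasible {M K J : ℕ} (θ : Fin J → Outcome M K) (v : Fin J → ℝ) (L : ℝ≥0)
    (x : Outcome M K) (j : Fin J) :
    ∃ g : Fin ((j + 1) + (j + 1) * M ^ 2 + M * K + 1) → (LPVars M K j →ᵃ[ℝ] ℝ),
      ∀ z : LPVars M K j, LPFeasible θ v L x j z ↔ ∀ c, 0 ≤ g c z := by
  have h1 : ∀ i : TopIndex j, ∃ g : LPVars M K j →ᵃ[ℝ] ℝ, ∀ z, g z =
      (∑ m, z.2.2.1 i m + ∑ m, z.2.2.2 i m - pairing z.2.1 x + z.1) + -v i := fun i =>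
    IsLinearMap.exists_affineMap ⟨fun a b => by
      simp [pairing, add_mul, Finset.sum_add_distrib]; ring, fun c a => by
      simp [pairing, mul_assoc, ← Finset.mul_sum]; ring⟩ _
  have h2 : ∀ q : TopIndex j × Fin M × Fin M, ∃ g : LPVars M K j →ᵃ[ℝ] ℝ, ∀ z, g z =
      (∑ k, θ q.1 q.2.1 k * z.2.1 q.2.2 k - z.2.2.1 q.1 q.2.1 - z.2.2.2 q.1 q.2.2) + 0 := fun q =>
    IsLinearMap.exists_affineMap ⟨fun a b => by
      simp [mul_add, Finset.sum_add_distrib]; ring, fun c a => by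
      simp [mul_left_comm _ c, ← Finset.mul_sum]; ring⟩ _
  have h3 : ∀ q : Fin M × Fin K, ∃ g : LPVars M K j →ᵃ[ℝ] ℝ, ∀ z, g z = z.2.1 q.1 q.2 + 0 :=
    fun q => IsLinearMap.exists_affineMap ⟨fun a b => by simp, fun c a => by simp⟩ _
  obtain ⟨g4, hg4⟩ : ∃ g : LPVars M K j →ᵃ[ℝ] ℝ, ∀ z, g z = (-∑ m, ∑ k, z.2.1 m k) + L :=
    IsLinearMap.exists_affineMap ⟨fun a b => by
      simp [Finset.sum_add_distrib]; ring, fun c a => by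
      simp [← Finset.mul_sum]⟩ _
  choose g1 hg1 using h1
  choose g2 hg2 using h2
  choose g3 hg3 using h3
  have hcard : Fintype.card (TopIndex j ⊕ (TopIndex j × Fin M × Fin M) ⊕ (Fin M × Fin K) ⊕ Unit) =
      (j + 1) + (j + 1) * M ^ 2 + M * K + 1 := by
    simp only [Fintype.card_sum, Fintype.card_prod, card_topIndex, Fintype.card_fin,
      Fintype.card_unit]
    ring
  let e := Fintype.equivFinOfCardEq hcard
  refine ⟨fun c => Sum.elim g1 (Sum.elim g2 (Sum.elim g3 fun _ => g4)) (e.symm c), ?_⟩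
  rintro ⟨u, ξ, y, w⟩
  rw [e.symm.forall_congr_left]
  simp only [Equiv.symm_symm, Equiv.symm_apply_apply, Sum.forall, Sum.elim_inl, Sum.elim_inr,
    Prod.forall, forall_const, hg1, hg2, hg3, hg4, LPFeasible, add_zero, ← sub_eq_add_neg]
  refine and_congr_right fun _ => and_congr_right fun _ => and_congr_right fun h0 => ?_
  simp only [abs_of_nonneg (h0 _ _)]
  constructor <;> intro h <;> linarith

theorem mainTheorem10 (M K J : ℕ) (hM : 1 ≤ M) (hK : 1 ≤ K) (hJ : 1 ≤ J)
    (X : Set (Outcome M K)) (hXconv : Convex ℝ X)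
    (hXperm : ∀ σ : Equiv.Perm (Fin M), ∀ y ∈ X, Outcome.permute σ y ∈ X)
    (θ : Fin J → Outcome M K) (hθ : ∀ i, θ i ∈ X)
    (v : Fin J → ℝ) (hv : Antitone v) (L : ℝ≥0)
    (x : Outcome M K) (hx : x ∈ X)
    (hXlow : ∀ (i : Fin J) (σ : Equiv.Perm (Fin M)),
      Outcome.permute σ (θ i) - ‖(Outcome.permute σ (θ i) - x)⁺‖ • (1 : Outcome M K) ∈ X) :
    IsGLB ((fun f : Outcome M K → ℝ => f x) '' ambiguitySet X θ v L) (worstCase X θ v L x) ∧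
    ∃ j : Fin J,
      levelSelection v (worstCase X θ v L x) = {j} ∧
      IsLeast (lpValues θ v L x j) (lpVal θ v L x j) ∧
      worstCase X θ v L x = min (v j) (lpVal θ v L x j) ∧
      Module.finrank ℝ (LPVars M K j) = 1 + M * K + 2 * ((j + 1) * M) ∧
      ∃ g : Fin ((j + 1) + (j + 1) * M ^ 2 + M * K + 1) → (LPVars M K j →ᵃ[ℝ] ℝ),
        ∀ z : LPVars M K j, LPFeasible θ v L x j z ↔ ∀ c, 0 ≤ g c z := by
  have : Nonempty (Fin M) := ⟨⟨0, hM⟩⟩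
  have hlower := fun f (hf : f ∈ ambiguitySet X θ v L) =>
    min_le_of_mem_ambiguitySet hM hXconv hXperm hθ hv hx hXlow hf
  have hV : ∀ i, v i ≤ v ⟨0, hJ⟩ := fun i => hv (Fin.le_def.2 (Nat.zero_le _))
  -- the constant function with value `v 0`
  obtain ⟨f₀, hf₀, hf₀x⟩ : ∃ f ∈ ambiguitySet X θ v L, f x ≤ v ⟨0, hJ⟩ :=
    exists_mem_ambiguitySet_le hXconv hV (j := ⟨0, hJ⟩) (fun i _ => hV i) (ξ := 0)
      (fun _ _ => le_rfl) (by simp) fun i σ => by simpa [pairing] using hV i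
  have hbdd : BddBelow ((fun f : Outcome M K → ℝ => f x) '' ambiguitySet X θ v L) := by
    refine ⟨min (v ⟨0, hJ⟩) (lpVal θ v L x ⟨0, hJ⟩), ?_⟩
    rintro _ ⟨f, hf, rfl⟩
    exact hlower f hf ⟨0, hJ⟩
  have hglb : IsGLB ((fun f : Outcome M K → ℝ => f x) '' ambiguitySet X θ v L)
      (worstCase X θ v L x) := isGLB_csInf ⟨f₀ x, f₀, hf₀, rfl⟩ hbdd
  obtain ⟨j, hj⟩ := exists_levelSelection_eq_singleton hv hJ
    ((hglb.1 ⟨f₀, hf₀, rfl⟩).trans hf₀x)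
  have hmem : j ∈ levelSelection v (worstCase X θ v L x) := hj ▸ rfl
  refine ⟨hglb, j, hj, isLeast_lpVal, le_antisymm (le_min hmem.2 ?_) ?_, finrank_lpVars M K j,
    exists_affine_lpFeasible θ v L x j⟩
  · by_contra! hlt
    -- raising the optimal value to the next data level keeps it below the worst case
    obtain ⟨u, hlpu, hu, hlt'⟩ : ∃ u, lpVal θ v L x j ≤ u ∧ (∀ i, j < i → v i ≤ u) ∧
        u < worstCase X θ v L x := by
      by_cases h : j.1 + 1 < J
      · exact ⟨max (lpVal θ v L x j) (v ⟨j.1 + 1, h⟩), le_max_left _ _,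
          fun i hi => le_max_of_le_right (hv (Fin.le_def.2 (Nat.succ_le_of_lt hi))),
          max_lt hlt (hmem.1 h)⟩
      · refine ⟨_, le_rfl, fun i hi => absurd i.2 ?_, hlt⟩
        have : j.1 < i.1 := hi
        omega
    obtain ⟨ξ, h0, hL, hξ⟩ := mem_lpValues_iff.1
      (isLeast_lpVal (θ := θ) (v := v) (L := L) (x := x) (j := j)).1
    obtain ⟨f, hf, hfx⟩ := exists_mem_ambiguitySet_le (X := X) (x := x) hXconv hV hu h0 hL
      fun i σ => (hξ i σ).trans (add_le_add hlpu le_rfl)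
    exact absurd (hglb.1 ⟨f, hf, rfl⟩) (not_le.2 (hfx.trans_lt hlt'))
  · refine hglb.2 ?_
    rintro _ ⟨f, hf, rfl⟩
    exact hlower f hf j
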